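/- Let $T_0$ be a finite rooted tree with $n_0\ge 1$ vertices, thought of as the organisational structure of a company: vertices are positions and the root is the position of the boss. A rooted subtree of $T_0$ is a connected set of vertices containing the root. The rooted subtrees are the states of two Markov chains started from $T_0$. In a state $T$ every vertex of $T$ is held by one employee. When an employee is fired, a uniformly chosen employee holding a position that is a strict descendant of the vacated position is promoted to it, the position thereby vacated is filled by the same rule, and so on, until the vacated position has no occupied strict descendants; this last position disappears. No firing occurs when only the boss remains. Write $n=|T|$. Single model: with probability $n/n_0$ one uniformly chosen employee is fired (with the promotion cascade), and with probability $(n_0-n)/n_0$ nothing changes. Binomial model with parameter $q_2\in[0,1]$: the performances of the $n$ employees are independent and uniform on $[0,1]$, and all employees with performance below $1-q_2$ are fired one by one in a uniformly random order (each firing followed by its promotion cascade). For each of the two models let $K(T,U)$ be the probability of moving from $T$ to $U$; a right eigenfunction with eigenvalue $\beta$ is a function $f\neq 0$ on the states with $\sum_U K(T,U)f(U)=\beta f(T)$ for all $T$. Then: (i) The eigenvalues of the single and binomial models are $\frac{j}{n_0}$ and $q_2^{\,n_0-j}$ respectively, for the integers $0\le j\le n_0-2$ and $j=n_0$. (ii)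 The eigenvalue $1$ ($j=n_0$) has multiplicity $1$, and for $0\le j\le n_0-2$ the multiplicity of the eigenvalue indexed by $j$ is the number $N_{n_0-j}$ of rooted subtrees of $T_0$ with $n_0-j$ vertices. That is, with $\beta_j=\frac{j}{n_0}$, respectively $\beta_j=q_2^{\,n_0-j}$, the characteristic polynomial of $K$ is $(x-1)\prod_{j=0}^{n_0-2}(x-\beta_j)^{N_{n_0-j}}$. In the single model, and in the binomial model with $0<q_2<1$, the $\beta_j$ ($0\le j\le n_0-2$) and $1$ are pairwise distinct, and these numbers are the algebraic and the geometric multiplicities of the individual eigenvalues; in the binomial model with $q_2=0$ this still holds for the eigenvalue $1$. (iii) For a rooted subtree $T'$ with $n'\ge 2$ vertices, the function $$f_{T'}(T)=\binom{n}{n'}\,\mathrm{Prob}\left(\text{after firing } n-n' \text{ uniformly chosen employees of } T \text{ (with the promotion cascades), the remaining structure is } T'\right),\qquad n=|T|,$$ (equal to $0$ for $n<n'$) is a right eigenfunction of both chains, with eigenvalue $\frac{n_0-n'}{n_0}$ in the single model and $q_2^{\,n'}$ in the binomial model. The functions $f_{T'}$, together with the constant function $1$ (which has eigenvalue $1$),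 form a basis of the space of real functions on the states. -/

import Mathlib

open MeasureTheory

namespace EmployeeFiring

/-- A rooted subtree of the rooted tree `T₀`: a connected set of vertices containing the root.
The tree order of `T₀` has the root `⊥` at the bottom, `v < w` says that `w` is a strict
descendant of `v`, and the tree as a graph is the Hasse diagram of this order. -/
@[ext]
structure RootedSubtree (T₀ : RootedTree) where
  verts : Finset T₀
  root_mem : ⊥ ∈ verts
  connected : ((SimpleGraph.hasse T₀).induce (verts : Set T₀)).Connected

section

variable {T₀ : RootedTree}

/-- The number of vertices of a rooted subtree. -/
def RootedSubtree.size (T : RootedSubtree T₀) : ℕ := T.verts.card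

theorem RootedSubtree.verts_injective :
    Function.Injective (RootedSubtree.verts : RootedSubtree T₀ → Finset T₀) :=
  fun _ _ h => RootedSubtree.ext h

theorem RootedSubtree.one_le_size (T : RootedSubtree T₀) : 1 ≤ T.size :=
  Finset.card_pos.mpr ⟨⊥, T.root_mem⟩

noncomputable instance [Fintype T₀] : Fintype (RootedSubtree T₀) :=
  Fintype.ofInjective RootedSubtree.verts RootedSubtree.verts_injective

noncomputable instance : DecidableEq (RootedSubtree T₀) := Classical.decEq _

/-- The number of rooted subtrees of `T₀` with `k` vertices. -/
noncomputable def numSubtrees (T₀ : RootedTree) [Fintype T₀] (k : ℕ) : ℕ :=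
  (Finset.univ.filter fun T : RootedSubtree T₀ => T.size = k).card

/-- A snapshot of the company during a month. Employees are named by the position that they hold
at the start of the month; `c e = some v` says that employee `e` currently holds position `v`, and
`c e = none` that there is no such employee (any more). -/
abbrev Company (T₀ : RootedTree) : Type _ := T₀ → Option T₀

/-- The company at the start of a month, with structure `T`. -/
noncomputable def Company.start (T : RootedSubtree T₀) : Company T₀ :=
  open Classical in fun e => if e ∈ T.verts then some e else none

/-- The structure of the company: the set of positions that are held by someone. -/
noncomputable def Company.positions [Fintype T₀] (c : Company T₀) : Finset T₀ :=
  open Classical in Finset.univ.filter fun v => ∃ e, c e = some v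

/-- The number of employees. -/
noncomputable def Company.headcount [Fintype T₀] (c : Company T₀) : ℕ :=
  (Finset.univ.filter fun e => (c e).isSome).card

/-- The employees further down the chain of superiority from position `v`, each paired with the
position that he holds. -/
def Company.Below (c : Company T₀) (v : T₀) : Type _ :=
  {p : T₀ × T₀ // c p.1 = some p.2 ∧ v < p.2}

noncomputable instance [Fintype T₀] (c : Company T₀) (v : T₀) : Fintype (c.Below v) :=
  open Classical in
  inferInstanceAs (Fintype {p : T₀ × T₀ // c p.1 = some p.2 ∧ v < p.2})

/-- The promotion cascade that fills the vacant position `v`: a uniformly chosen employee from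
further down is promoted to `v`, and then his former position is filled in the same way. A vacant
position with nobody further down disappears. -/
noncomputable def Company.promote [Fintype T₀] (c : Company T₀) (v : T₀) : PMF (Company T₀) :=
  open Classical in
  if _h : Nonempty (c.Below v) then
    (PMF.uniformOfFintype (c.Below v)).bind fun p =>
      Company.promote (Function.update c p.1.1 (some v)) p.1.2
  else PMF.pure c
termination_by (open Classical in (Finset.univ.filter fun w => v < w).card)
decreasing_by
  classical
  refine Finset.card_lt_card (Finset.ssubset_iff_of_subset ?_ |>.mpr ⟨p.1.2, ?_, ?_⟩)
  · intro w hw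
    simp only [Finset.mem_filter, Finset.mem_univ, true_and] at hw ⊢
    exact p.2.2.trans hw
  · simpa using p.2.2
  · simp

/-- Employee `e` is fired, with the subsequent promotion cascade. Nobody is fired when only one
employee (the boss) remains. -/
noncomputable def Company.fire [Fintype T₀] (c : Company T₀) (e : T₀) : PMF (Company T₀) :=
  open Classical in
  match c e with
  | none => PMF.pure c
  | some v => if c.headcount ≤ 1 then PMF.pure c
      else Company.promote (Function.update c e none) v

/-- The employees in `S` are fired one by one in a uniformly random order, each firing being
followed by its promotion cascade. -/
noncomputable def Company.fireAll [Fintype T₀] (c : Company T₀) (S : Finset T₀) :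
    PMF (Company T₀) :=
  open Classical in
  if _h : Nonempty S then
    (PMF.uniformOfFintype S).bind fun e =>
      (c.fire e).bind fun c' => Company.fireAll c' (S.erase e)
  else PMF.pure c
termination_by S.card
decreasing_by
  classical
  exact Finset.card_erase_lt_of_mem e.2

/-- The random structure left of `T` after the employees in `S` have been fired. -/
noncomputable def fireSet [Fintype T₀] (T : RootedSubtree T₀) (S : Finset T₀) :
    PMF (Finset T₀) :=
  ((Company.start T).fireAll S).map Company.positions

/-- The random structure left of `T` after `k` uniformly chosen employees have been fired. -/
noncomputable def fireUniform [Fintype T₀] (T : RootedSubtree T₀) (k : ℕ) (hk : k ≤ T.size) :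
    PMF (Finset T₀) :=
  (PMF.uniformOfFinset (T.verts.powersetCard k) (Finset.powersetCard_nonempty.mpr hk)).bind
    fun S => fireSet T S

/-- The transition matrix of the single model; rows are indexed by the source state. -/
noncomputable def singleMatrix (T₀ : RootedTree) [Fintype T₀] :
    Matrix (RootedSubtree T₀) (RootedSubtree T₀) ℝ :=
  Matrix.of fun T U =>
    (T.size : ℝ) / Fintype.card T₀ * (fireUniform T 1 T.one_le_size U.verts).toReal +
      ((Fintype.card T₀ : ℝ) - T.size) / Fintype.card T₀ * (if T = U then 1 else 0)

/-- The probability that exactly the employees in `S` have performance below `1 - q`, if the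
performances of the employees of `T` are independent and uniform on `[0, 1]`. -/
noncomputable def badPerformanceProb (T : RootedSubtree T₀) (q : ℝ) (S : Finset T₀) : ℝ :=
  (volume : Measure (T.verts → unitInterval)).real
    {x | ∀ e : T.verts, (e : T₀) ∈ S ↔ (x e : ℝ) < 1 - q}

/-- The transition matrix of the binomial model with parameter `q`; rows are indexed by the source
state. -/
noncomputable def binomialMatrix (T₀ : RootedTree) [Fintype T₀] (q : ℝ) :
    Matrix (RootedSubtree T₀) (RootedSubtree T₀) ℝ :=
  Matrix.of fun T U =>
    ∑ S ∈ T.verts.powerset, badPerformanceProb T q S * (fireSet T S U.verts).toReal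

/-- The function `f_{T'}`: its value at `T`, with `n` and `n'` the sizes of `T` and `T'`, is
`n.choose n'` times the probability that `T'` is left of `T` after firing `n - n'` uniformly chosen
employees. (For `n < n'` the binomial coefficient is zero.) -/
noncomputable def subtreeFun [Fintype T₀] (T' : RootedSubtree T₀) : RootedSubtree T₀ → ℝ :=
  fun T => (T.size.choose T'.size : ℝ) *
    (fireUniform T (T.size - T'.size) (Nat.sub_le _ _) T'.verts).toReal

end

end EmployeeFiring

namespace EmployeeFiring

/-! ### Rooted subtrees as lower sets -/

section Subtrees

variable {T₀ : RootedTree}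

/-! Let `P` be the chain that fires one uniformly chosen employee (`fireOne`). The heart of the
proof is that firing a uniform `k`-set in uniform order is the same as `k` steps of `P`
(`fireUniform_eq_map_fireIter`). The first person fired is uniform, the rest form a uniform
`(k-1)`-subset of the others, and since cascades see only positions, the company left by the first
firing can be renamed to a fresh company on the remaining tree.

`P` removes exactly one vertex per step until the root alone is left, where it stops. So `f_{T'}(T)
= C(n,n') P^(n-n')(T,T')`, and for `n' ≥ 2` the semigroup law gives `(P^k f_{T'})(T) = C(n-k,n')
P^(n-n')(T,T')` (`sum_fireIter_mul_subtreeFun`). Each model is a mixture of powers of `P` with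
weights depending only on `n`, so the eigenvalue equations reduce to `n C(n-1,n') = (n-n') C(n,n')`
and `∑_k C(n,k) (1-q)^k q^(n-k) C(n-k,n') = q^n' C(n,n')`.

Ordered by size, the `f_{T'}` and the constant function form a unitriangular matrix, hence a basis
(`linearIndependent_eigenFun`). Both kernels are thereby diagonalized with one basis vector per tree
and an eigenvalue depending only on its size; counting trees by size gives the spectrum and the
multiplicities. -/

theorem RootedSubtree.verts_nonempty (T : RootedSubtree T₀) : T.verts.Nonempty :=
  ⟨⊥, T.root_mem⟩

/-- Each vertex has a single parent, so a walk in the Hasse diagram that starts above a missing `w`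
cannot leave the vertices above `w` without visiting `w`, and hence never reaches the root. -/
theorem RootedSubtree.isLowerSet (T : RootedSubtree T₀) : IsLowerSet (T.verts : Set T₀) := by
  intro v w hwv hv
  by_contra hw
  obtain ⟨p⟩ := T.connected.preconnected ⟨v, hv⟩ ⟨⊥, T.root_mem⟩
  have key : ∀ (x y : (T.verts : Set T₀)),
      ((SimpleGraph.hasse T₀).induce (T.verts : Set T₀)).Walk x y → w ≤ x → w ≤ y := by
    intro x y p
    induction p with
    | nil => exact id
    | @cons x z y h p ih =>
      intro hx
      apply ih
      rcases h with h | h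
      · exact hx.trans h.le
      · have hlt : w < x := lt_of_le_of_ne hx (by rintro rfl; exact hw x.2)
        exact (Order.le_pred_of_lt hlt).trans h.pred_eq.le
  have := key _ _ p hwv
  rw [le_bot_iff] at this
  exact hw (this ▸ T.root_mem)

theorem connected_induce_hasse_of_isLowerSet [Finite T₀] {A : Set T₀} (hA : IsLowerSet A)
    (hbot : ⊥ ∈ A) : ((SimpleGraph.hasse T₀).induce A).Connected := by
  have key : ∀ v : T₀, ∀ hv : v ∈ A,
      ((SimpleGraph.hasse T₀).induce A).Reachable ⟨v, hv⟩ ⟨⊥, hbot⟩ := by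
    intro v
    induction v using WellFoundedLT.induction with
    | ind v ih =>
      intro hv
      by_cases h : v = ⊥
      · subst h; exact SimpleGraph.Reachable.refl _
      · have hmin : ¬ IsMin v := by rwa [isMin_iff_eq_bot]
        have hlt := Order.pred_lt_of_not_isMin hmin
        have hm : Order.pred v ∈ A := hA hlt.le hv
        refine SimpleGraph.Reachable.trans ?_ (ih _ hlt hm)
        apply SimpleGraph.Adj.reachable
        exact Or.inr (Order.pred_covBy_of_not_isMin hmin)
  have : Nonempty A := ⟨⟨⊥, hbot⟩⟩
  exact ⟨fun x y => (key x.1 x.2).trans (key y.1 y.2).symm⟩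

/-- A finite lower set that contains the root, as a rooted subtree. -/
def RootedSubtree.ofIsLowerSet [Finite T₀] (A : Finset T₀) (hA : IsLowerSet (A : Set T₀))
    (hbot : ⊥ ∈ A) : RootedSubtree T₀ :=
  ⟨A, hbot, connected_induce_hasse_of_isLowerSet hA (by simpa using hbot)⟩

/-- The subtree that consists of the root alone. -/
def RootedSubtree.single (T₀ : RootedTree) [Finite T₀] : RootedSubtree T₀ :=
  .ofIsLowerSet {⊥} (by intro a b h; simp; rintro rfl; simpa using h) (by simp)

theorem RootedSubtree.eq_single_of_size_eq_one [Finite T₀] {T : RootedSubtree T₀}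
    (h : T.size = 1) : T = .single T₀ := by
  obtain ⟨v, hv⟩ := Finset.card_eq_one.mp h
  apply RootedSubtree.ext
  have := T.root_mem
  rw [hv, Finset.mem_singleton] at this
  rw [hv, ← this]; rfl

@[simp]
theorem RootedSubtree.size_single [Finite T₀] : (RootedSubtree.single T₀).size = 1 := rfl

end Subtrees

/-! ### Invariants of the promotion cascade -/

section Support

variable {T₀ : RootedTree}

/-- No two employees hold the same position. -/
def Company.Inj (c : Company T₀) : Prop :=
  ∀ e e' w, c e = some w → c e' = some w → e = e'

/-- The positions held form a rooted subtree: they are a nonempty lower set. -/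
structure Company.Proper (c : Company T₀) : Prop where
  inj : c.Inj
  lower : ∀ e u w, c e = some u → w ≤ u → ∃ e', c e' = some w
  nonempty : ∃ e v, c e = some v

/-- Position `v` is vacant, and with it the positions held would form a lower set. -/
structure Company.Vacant (c : Company T₀) (v : T₀) : Prop where
  inj : c.Inj
  vacant : ∀ e, c e ≠ some v
  lower : ∀ e u w, c e = some u → w ≤ u → w = v ∨ ∃ e', c e' = some w

theorem Company.proper_start (T : RootedSubtree T₀) : (Company.start T).Proper := by
  classical
  refine ⟨?_, ?_, ?_⟩
  · intro a b w ha hb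
    simp only [start] at ha hb
    split_ifs at ha hb
    cases ha; cases hb; rfl
  · intro e u w he hw
    simp only [start] at he
    split_ifs at he with h
    cases he
    exact ⟨w, if_pos (T.isLowerSet hw h)⟩
  · exact ⟨⊥, ⊥, if_pos T.root_mem⟩

@[simp]
theorem Company.isSome_start (T : RootedSubtree T₀) (e : T₀) :
    (Company.start T e).isSome ↔ e ∈ T.verts := by
  simp only [start]
  split_ifs with h <;> simp [h]

open scoped Classical in
theorem Company.Vacant.update {c : Company T₀} {v : T₀} (hc : c.Vacant v) (p : c.Below v) :
    Company.Vacant (Function.update c p.1.1 (some v)) p.1.2 := by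
  obtain ⟨⟨e₀, w₀⟩, h₁, h₂⟩ := p
  simp only at h₁ h₂ ⊢
  obtain ⟨inj, vac, low⟩ := hc
  refine ⟨?_, ?_, ?_⟩
  · intro e e' w h h'
    simp only [Function.update_apply] at h h'
    split_ifs at h h' with ha hb hb
    · rw [ha, hb]
    · cases h; exact absurd h' (vac _)
    · cases h'; exact absurd h (vac _)
    · exact inj _ _ _ h h'
  · intro e h
    simp only [Function.update_apply] at h
    split_ifs at h with ha
    · cases h; exact lt_irrefl _ h₂
    · exact ha (inj _ _ _ h h₁)
  · have aux : ∀ u w, (∃ e, c e = some u) → w ≤ u →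
        w = w₀ ∨ ∃ e', Function.update c e₀ (some v) e' = some w := by
      rintro u w ⟨e, h⟩ hw
      rcases low e u w h hw with rfl | ⟨e', he'⟩
      · exact Or.inr ⟨e₀, by simp⟩
      · by_cases h' : e' = e₀
        · subst h'; rw [h₁] at he'; cases he'; exact Or.inl rfl
        · exact Or.inr ⟨e', by simp [h', he']⟩
    intro e u w h hw
    simp only [Function.update_apply] at h
    split_ifs at h with ha
    -- The promoted employee now holds `v`. Since `v < w₀`, the positions below `v` are already
    -- covered by closure below his old position `w₀`.
    · cases h
      exact aux w₀ w ⟨_, h₁⟩ (hw.trans h₂.le)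
    · exact aux u w ⟨_, h⟩ hw

open scoped Classical in
theorem Company.Proper.vacant_update {c : Company T₀} (hc : c.Proper) {e v : T₀}
    (he : c e = some v) : Company.Vacant (Function.update c e none) v := by
  refine ⟨?_, ?_, ?_⟩
  · intro a b w ha hb
    simp only [Function.update_apply] at ha hb
    split_ifs at ha hb
    exact hc.inj _ _ _ ha hb
  · intro a ha
    simp only [Function.update_apply] at ha
    split_ifs at ha with h
    exact h (hc.inj _ _ _ ha he)
  · intro a u w ha hw
    simp only [Function.update_apply] at ha
    split_ifs at ha
    obtain ⟨b, hb⟩ := hc.lower _ _ _ ha hw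
    by_cases h : b = e
    · subst h; rw [he] at hb; cases hb; exact Or.inl rfl
    · exact Or.inr ⟨b, by simp [h, hb]⟩

variable [Fintype T₀]

theorem Company.mem_positions {c : Company T₀} {v : T₀} :
    v ∈ c.positions ↔ ∃ e, c e = some v := by
  simp [positions]

open scoped Classical in
theorem Company.promote_of_nonempty {c : Company T₀} {v : T₀} (h : Nonempty (c.Below v)) :
    c.promote v = (PMF.uniformOfFintype (c.Below v)).bind fun p =>
      Company.promote (Function.update c p.1.1 (some v)) p.1.2 := by
  rw [Company.promote, dif_pos h]

theorem Company.promote_of_isEmpty {c : Company T₀} {v : T₀} (h : ¬ Nonempty (c.Below v)) :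
    c.promote v = PMF.pure c := by
  rw [Company.promote, dif_neg h]

open scoped Classical in
/-- Induction along the promotion cascade. -/
theorem Company.cascade_induction {P : Company T₀ → T₀ → Prop}
    (ih : ∀ c v, (∀ p : Company.Below c v, P (Function.update c p.1.1 (some v)) p.1.2) → P c v)
    (c : Company T₀) (v : T₀) : P c v := by
  induction v using WellFoundedGT.induction generalizing c with
  | ind v h => exact ih c v fun p => h _ p.2.2 _

/-- Each promotion moves the gap further down without changing who is employed. When the cascade
stops, nobody is below the gap, so dropping it leaves a lower set. -/
theorem Company.promote_support (c : Company T₀) (v : T₀) (hc : c.Vacant v)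
    (hne : ∃ e w, c e = some w) (c' : Company T₀) (hc' : c' ∈ (c.promote v).support) :
    c'.Proper ∧ ∀ e, (c' e).isSome = (c e).isSome := by
  classical
  induction c, v using Company.cascade_induction with
  | ih c v ih =>
    by_cases h : Nonempty (Company.Below c v)
    · rw [promote_of_nonempty h, PMF.mem_support_bind_iff] at hc'
      obtain ⟨p, -, hp⟩ := hc'
      obtain ⟨h1, h2⟩ := ih p (hc.update p) ⟨p.1.1, v, by simp⟩ hp
      refine ⟨h1, fun e => ?_⟩
      rw [h2, Function.update_apply]
      split_ifs with he
      · rw [he, p.2.1]; rfl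
      · rfl
    · rw [promote_of_isEmpty h, PMF.mem_support_pure_iff] at hc'
      subst hc'
      refine ⟨⟨hc.inj, fun e u w hu hw => ?_, hne⟩, fun _ => rfl⟩
      rcases hc.lower e u w hu hw with rfl | h'
      · rcases hw.eq_or_lt with rfl | hlt
        · exact ⟨e, hu⟩
        · exact absurd ⟨⟨(e, u), hu, hlt⟩⟩ h
      · exact h'

theorem Company.fire_of_headcount_le_one {c : Company T₀} (h : c.headcount ≤ 1) (e : T₀) :
    c.fire e = PMF.pure c := by
  unfold Company.fire
  split
  · rfl
  · rw [if_pos h]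

open scoped Classical in
theorem Company.fire_support {c : Company T₀} (hc : c.Proper) {e : T₀} (he : (c e).isSome)
    (hn : 1 < c.headcount) {c' : Company T₀} (hc' : c' ∈ (c.fire e).support) :
    c'.Proper ∧ ∀ a, (c' a).isSome = if a = e then false else (c a).isSome := by
  obtain ⟨v, hv⟩ := Option.isSome_iff_exists.mp he
  have : c.fire e = Company.promote (Function.update c e none) v := by
    unfold Company.fire
    rw [hv]
    simp only
    rw [if_neg (by omega)]
  rw [this] at hc'
  have hne : ∃ b w, Function.update c e none b = some w := by
    obtain ⟨b, hb, hbe⟩ := Finset.exists_mem_ne hn e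
    rw [Finset.mem_filter, Option.isSome_iff_exists] at hb
    obtain ⟨-, w, hw⟩ := hb
    exact ⟨b, w, by simp [hbe, hw]⟩
  obtain ⟨h1, h2⟩ := promote_support _ _ (hc.vacant_update hv) hne _ hc'
  refine ⟨h1, fun a => ?_⟩
  rw [h2, Function.update_apply]
  split_ifs <;> rfl

open scoped Classical in
/-- The structure of a proper company as a rooted subtree. -/
noncomputable def Company.tree (c : Company T₀) : RootedSubtree T₀ :=
  if h : c.Proper then
    .ofIsLowerSet c.positions
      (by
        intro a b hab ha
        simp only [positions, Finset.coe_filter, Finset.mem_univ, true_and,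
          Set.mem_ofPred_eq] at ha ⊢
        obtain ⟨e, he⟩ := ha
        exact h.lower e a b he hab)
      (by
        obtain ⟨e, v, he⟩ := h.nonempty
        simpa [positions] using h.lower e v ⊥ he bot_le)
  -- An arbitrary default: the firings considered lead only to proper companies.
  else .single T₀

theorem Company.Proper.verts_tree {c : Company T₀} (h : c.Proper) :
    c.tree.verts = c.positions := by
  rw [tree, dif_pos h]; rfl

theorem Company.Proper.size_tree {c : Company T₀} (h : c.Proper) :
    c.tree.size = c.headcount := by
  classical
  rw [RootedSubtree.size, h.verts_tree]
  symm
  have := h.inj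
  refine Finset.card_bij (fun e he => (c e).get (by simpa using he)) ?_ ?_ ?_
  · intro e he
    simp only [positions, Finset.mem_filter, Finset.mem_univ, true_and]
    exact ⟨e, by simp⟩
  · intro a ha b hb hab
    exact h.inj a b ((c a).get (by simpa using ha)) (by simp) (by rw [hab]; simp)
  · intro v hv
    simp only [positions, Finset.mem_filter, Finset.mem_univ, true_and] at hv
    obtain ⟨e, he⟩ := hv
    exact ⟨e, by simp [he], by simp [he]⟩

@[simp]
theorem Company.headcount_start (T : RootedSubtree T₀) :
    (Company.start T).headcount = T.size := by
  classical
  simp [headcount, RootedSubtree.size]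

@[simp]
theorem Company.positions_start (T : RootedSubtree T₀) :
    (Company.start T).positions = T.verts := by
  classical
  ext v
  rw [mem_positions]
  simp only [start]
  constructor
  · rintro ⟨e, he⟩
    split_ifs at he with h
    cases he; exact h
  · exact fun h => ⟨v, if_pos h⟩

@[simp]
theorem Company.tree_start (T : RootedSubtree T₀) : (Company.start T).tree = T :=
  RootedSubtree.ext (by rw [(proper_start T).verts_tree, positions_start])

end Support

/-! ### Uniform choices -/

section Uniform

theorem uniformOfFintype_bind_equiv {α β γ : Type*} [Fintype α] [Nonempty α] [Fintype β]
    [Nonempty β] (σ : α ≃ β) (f : β → PMF γ) :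
    (PMF.uniformOfFintype β).bind f = (PMF.uniformOfFintype α).bind fun a => f (σ a) := by
  ext x
  simp only [PMF.bind_apply, PMF.uniformOfFintype_apply]
  rw [Fintype.card_congr σ, ← σ.tsum_eq]

theorem uniformOfFintype_bind_apply {α γ : Type*} [Fintype α] [Nonempty α]
    (f : α → PMF γ) (x : γ) :
    (PMF.uniformOfFintype α).bind f x = (Fintype.card α : ENNReal)⁻¹ * ∑ a, f a x := by
  simp only [PMF.bind_apply, PMF.uniformOfFintype_apply]
  rw [ENNReal.tsum_mul_left, tsum_fintype]

theorem uniformOfFinset_bind_apply {α γ : Type*} (s : Finset α) (hs : s.Nonempty)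
    (f : α → PMF γ) (x : γ) :
    (PMF.uniformOfFinset s hs).bind f x = (s.card : ENNReal)⁻¹ * ∑ a ∈ s, f a x := by
  classical
  rw [PMF.bind_apply, tsum_eq_sum (s := s), Finset.mul_sum]
  · exact Finset.sum_congr rfl fun a ha => by rw [PMF.uniformOfFinset_apply_of_mem _ ha]
  · intro a ha
    rw [PMF.uniformOfFinset_apply_of_notMem _ ha, zero_mul]

/-- Drawing a set and then its first element amounts to drawing the first element and then a set
among the others. -/
theorem sum_powersetCard_succ_sum_erase {α M : Type*} [DecidableEq α] [AddCommMonoid M]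
    (A : Finset α) (k : ℕ) (G : α → Finset α → M) :
    ∑ S ∈ A.powersetCard (k + 1), ∑ e ∈ S, G e (S.erase e) =
      ∑ e ∈ A, ∑ S ∈ (A.erase e).powersetCard k, G e S := by
  rw [Finset.sum_sigma', Finset.sum_sigma']
  refine Finset.sum_bij' (fun x _ => ⟨x.2, x.1.erase x.2⟩) (fun x _ => ⟨insert x.1 x.2, x.1⟩)
    ?_ ?_ ?_ ?_ ?_
  · rintro ⟨S, e⟩ h
    simp only [Finset.mem_sigma, Finset.mem_powersetCard] at h ⊢
    obtain ⟨⟨h1, h2⟩, h3⟩ := h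
    exact ⟨h1 h3, Finset.erase_subset_erase _ h1, by rw [Finset.card_erase_of_mem h3]; omega⟩
  · rintro ⟨e, S⟩ h
    simp only [Finset.mem_sigma, Finset.mem_powersetCard] at h ⊢
    obtain ⟨h1, h2, h3⟩ := h
    have he : e ∉ S := fun h' => by simpa using h2 h'
    refine ⟨⟨Finset.insert_subset h1 (h2.trans (Finset.erase_subset _ _)), ?_⟩, by simp⟩
    rw [Finset.card_insert_of_notMem he, h3]
  · rintro ⟨S, e⟩ h
    simp only [Finset.mem_sigma] at h
    simp [Finset.insert_erase h.2]
  · rintro ⟨e, S⟩ h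
    simp only [Finset.mem_sigma, Finset.mem_powersetCard] at h
    have he : e ∉ S := fun h' => by simpa using h.2.1 h'
    simp [Finset.erase_insert he]
  · rintro ⟨S, e⟩ h
    rfl

end Uniform

/-! ### Equivariance under renaming employees -/

section Renaming

variable {T₀ : RootedTree} [Fintype T₀]

/-- The rule looks only at positions. Equivariance matters because after a firing the employees need
no longer hold the positions that name them. -/
theorem Company.promote_comp (φ : Equiv.Perm T₀) (c : Company T₀) (v : T₀) :
    Company.promote (c ∘ φ) v = (c.promote v).map (· ∘ φ) := by
  classical
  induction c, v using Company.cascade_induction with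
  | ih c v ih =>
    let σ : Company.Below (c ∘ φ) v ≃ Company.Below c v :=
      { toFun := fun p => ⟨(φ p.1.1, p.1.2), p.2⟩
        invFun := fun p => ⟨(φ.symm p.1.1, p.1.2), by simpa using p.2⟩
        left_inv := fun p => Subtype.ext (by simp)
        right_inv := fun p => Subtype.ext (by simp) }
    by_cases h : Nonempty (Company.Below c v)
    · have h' : Nonempty (Company.Below (c ∘ φ) v) := σ.nonempty_congr.mpr h
      rw [promote_of_nonempty h, promote_of_nonempty h', PMF.map_bind,
        uniformOfFintype_bind_equiv σ]
      congr 1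
      funext p
      rw [← ih (σ p)]
      congr 1
      funext e
      simp only [Function.update_apply, Function.comp_apply]
      exact if_congr (φ.injective.eq_iff).symm rfl rfl
    · have h' : ¬ Nonempty (Company.Below (c ∘ φ) v) := fun h' => h (σ.nonempty_congr.mp h')
      rw [promote_of_isEmpty h, promote_of_isEmpty h', PMF.pure_map]

theorem Company.headcount_comp (φ : Equiv.Perm T₀) (c : Company T₀) :
    Company.headcount (c ∘ φ) = c.headcount := by
  classical
  unfold headcount
  refine Finset.card_bij (fun e _ => φ e) ?_ ?_ ?_
  · intro e he; simpa using he
  · intro a _ b _ h; exact φ.injective h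
  · intro e he; exact ⟨φ.symm e, by simpa using he, by simp⟩

theorem Company.positions_comp (φ : Equiv.Perm T₀) (c : Company T₀) :
    Company.positions (c ∘ φ) = c.positions := by
  ext v
  rw [mem_positions, mem_positions]
  exact ⟨fun ⟨e, h⟩ => ⟨φ e, h⟩, fun ⟨e, h⟩ => ⟨φ.symm e, by simpa using h⟩⟩

theorem Company.fire_comp (φ : Equiv.Perm T₀) (c : Company T₀) (e : T₀) :
    Company.fire (c ∘ φ) e = (c.fire (φ e)).map (· ∘ φ) := by
  classical
  unfold Company.fire
  rw [headcount_comp, Function.comp_apply]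
  cases h : c (φ e) with
  | none => simp only [PMF.pure_map]
  | some v =>
    simp only
    split_ifs
    · rw [PMF.pure_map]
    · rw [← promote_comp]
      congr 1
      funext a
      simp only [Function.update_apply, Function.comp_apply]
      exact if_congr (φ.injective.eq_iff).symm rfl rfl

theorem Company.fireAll_empty (c : Company T₀) : c.fireAll ∅ = PMF.pure c := by
  rw [Company.fireAll, dif_neg (by simp)]

open scoped Classical in
theorem Company.fireAll_of_nonempty (c : Company T₀) {S : Finset T₀} (h : Nonempty S) :
    c.fireAll S = (PMF.uniformOfFintype S).bind fun e =>
      (c.fire e).bind fun c' => Company.fireAll c' (S.erase e) := by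
  rw [Company.fireAll, dif_pos h]

theorem Company.fireAll_comp (φ : Equiv.Perm T₀) (c : Company T₀) (S : Finset T₀) :
    Company.fireAll (c ∘ φ) S = (c.fireAll (S.map φ.toEmbedding)).map (· ∘ φ) := by
  classical
  induction S using Finset.strongInduction generalizing c with
  | H S ih =>
    by_cases h : Nonempty S
    · let σ : S ≃ (S.map φ.toEmbedding : Finset T₀) :=
        { toFun := fun e => ⟨φ e, by simp⟩
          invFun := fun e => ⟨φ.symm e, by
            obtain ⟨e, he⟩ := e
            obtain ⟨a, ha, rfl⟩ := Finset.mem_map.mp he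
            simpa using ha⟩
          left_inv := fun e => by simp
          right_inv := fun e => by simp }
      have h' : Nonempty (S.map φ.toEmbedding : Finset T₀) := σ.nonempty_congr.mp h
      rw [fireAll_of_nonempty _ h, fireAll_of_nonempty _ h', PMF.map_bind,
        uniformOfFintype_bind_equiv σ]
      congr 1
      funext e
      rw [fire_comp, PMF.bind_map, PMF.map_bind]
      congr 1
      funext c'
      rw [Function.comp_apply, ih _ (Finset.erase_ssubset e.2), Finset.map_erase]
      rfl
    · have hS : S = ∅ := Finset.eq_empty_of_forall_notMem fun a ha => h ⟨⟨a, ha⟩⟩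
      subst hS
      rw [Finset.map_empty, fireAll_empty, fireAll_empty, PMF.pure_map]

/-- The employees of a proper company can be renamed by their positions. -/
theorem Company.Proper.exists_perm {c : Company T₀} (hc : c.Proper) :
    ∃ φ : Equiv.Perm T₀, c = Company.start c.tree ∘ φ := by
  classical
  let f : {e // (c e).isSome} → {v // v ∈ c.positions} := fun e =>
    ⟨(c e).get e.2, mem_positions.mpr ⟨e, by simp⟩⟩
  have hf : Function.Bijective f := by
    constructor
    · intro a b hab
      have hab' : (c a).get a.2 = (c b).get b.2 := congrArg Subtype.val hab
      exact Subtype.ext (hc.inj a b ((c a).get a.2) (by simp) (by rw [hab']; simp))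
    · rintro ⟨v, hv⟩
      obtain ⟨e, he⟩ := mem_positions.mp hv
      exact ⟨⟨e, by simp [he]⟩, by simp [f, he]⟩
  -- By finiteness the bijection from employees to held positions extends to a permutation; unused
  -- names go to unheld positions.
  refine ⟨(Equiv.ofBijective f hf).extendSubtype, ?_⟩
  funext e
  simp only [Function.comp_apply, start, hc.verts_tree]
  by_cases he : (c e).isSome
  · rw [if_pos (Equiv.extendSubtype_mem _ e he), Equiv.extendSubtype_apply_of_mem _ e he]
    simp [f]
  · rw [if_neg (Equiv.extendSubtype_not_mem _ e he)]
    simpa using he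

end Renaming

/-! ### Uniform firing as an iterated one-step chain -/

section Iterate

variable {T₀ : RootedTree} [Fintype T₀]

/-- The structure left of `T` after one uniformly chosen employee has been fired. -/
noncomputable def fireOne (T : RootedSubtree T₀) : PMF (RootedSubtree T₀) :=
  (PMF.uniformOfFinset T.verts T.verts_nonempty).bind fun e =>
    ((Company.start T).fire e).map Company.tree

/-- The structure left of `T` after `k` successive uniform firings. -/
noncomputable def fireIter : ℕ → RootedSubtree T₀ → PMF (RootedSubtree T₀)
  | 0, T => PMF.pure T
  | k + 1, T => (fireOne T).bind (fireIter k)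

theorem fireUniform_apply (T : RootedSubtree T₀) (k : ℕ) (hk : k ≤ T.size) (b : Finset T₀) :
    fireUniform T k hk b =
      (T.size.choose k : ENNReal)⁻¹ * ∑ S ∈ T.verts.powersetCard k, fireSet T S b := by
  rw [fireUniform, uniformOfFinset_bind_apply, Finset.card_powersetCard, RootedSubtree.size]

/-- Renaming turns an average over `k`-sets of current employees `A` into one over `k`-sets of
positions of `c.tree`. This restarts the process after a firing. -/
theorem Company.Proper.fireUniform_tree_apply {c : Company T₀} (hc : c.Proper) {A : Finset T₀}
    (hA : ∀ e, (c e).isSome ↔ e ∈ A) (k : ℕ) (hk : k ≤ c.tree.size) (b : Finset T₀) :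
    fireUniform c.tree k hk b = (A.card.choose k : ENNReal)⁻¹ *
      ∑ S ∈ A.powersetCard k, (c.fireAll S).map Company.positions b := by
  obtain ⟨φ, hφ⟩ := hc.exists_perm
  have hverts : c.tree.verts = A.map φ.toEmbedding := by
    ext v
    obtain ⟨e, rfl⟩ := φ.surjective v
    have h := hA e
    rw [hφ, Function.comp_apply, isSome_start] at h
    rw [h]; simp
  rw [fireUniform_apply, RootedSubtree.size, hverts, Finset.card_map, Finset.powersetCard_map,
    Finset.sum_map]
  congr 1
  refine Finset.sum_congr rfl fun S _ => ?_
  conv_rhs => rw [hφ, fireAll_comp, PMF.map_comp]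
  rw [fireSet]
  congr 2
  funext d
  exact (positions_comp φ d).symm

open scoped Classical in
theorem fireSet_apply_of_nonempty (T : RootedSubtree T₀) {S : Finset T₀} (hS : S.Nonempty)
    (b : Finset T₀) :
    fireSet T S b = (S.card : ENNReal)⁻¹ * ∑ e ∈ S,
      ((Company.start T).fire e).bind
        (fun c => (c.fireAll (S.erase e)).map Company.positions) b := by
  rw [fireSet, Company.fireAll_of_nonempty _ hS.to_subtype, PMF.map_bind]
  have := hS.to_subtype
  rw [uniformOfFintype_bind_apply, Fintype.card_coe]
  simp only [PMF.map_bind]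
  congr 1
  exact Finset.sum_coe_sort S fun e => ((Company.start T).fire e).bind
    (fun c => (c.fireAll (S.erase e)).map Company.positions) b

theorem proper_of_mem_support_fire {T : RootedSubtree T₀} {e : T₀} (he : e ∈ T.verts)
    {c : Company T₀} (hc : c ∈ ((Company.start T).fire e).support) : c.Proper := by
  by_cases h : 1 < T.size
  · exact (Company.fire_support (Company.proper_start T) (by simpa using he)
      (by simpa using h) hc).1
  · rw [Company.fire_of_headcount_le_one (by simpa using h), PMF.mem_support_pure_iff] at hc
    rw [hc]; exact Company.proper_start T

open scoped Classical in
theorem isSome_iff_of_mem_support_fire {T : RootedSubtree T₀} (hT : 1 < T.size) {e : T₀}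
    (he : e ∈ T.verts) {c : Company T₀} (hc : c ∈ ((Company.start T).fire e).support) (a : T₀) :
    (c a).isSome ↔ a ∈ T.verts.erase e := by
  have := (Company.fire_support (Company.proper_start T) (by simpa using he)
      (by simpa using hT) hc).2 a
  rw [this]
  split_ifs with h
  · simp [h]
  · simp [h]

theorem size_tree_of_mem_support_fire {T : RootedSubtree T₀} (hT : 1 < T.size) {e : T₀}
    (he : e ∈ T.verts) {c : Company T₀} (hc : c ∈ ((Company.start T).fire e).support) :
    c.tree.size + 1 = T.size := by
  classical
  rw [(proper_of_mem_support_fire he hc).size_tree, Company.headcount]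
  have : (Finset.univ.filter fun a => (c a).isSome) = T.verts.erase e := by
    ext a
    rw [Finset.mem_filter, isSome_iff_of_mem_support_fire hT he hc]
    simp
  rw [this]
  exact Finset.card_erase_add_one he

theorem size_of_mem_support_fireOne {T U : RootedSubtree T₀} (hT : 1 < T.size)
    (hU : U ∈ (fireOne T).support) : U.size + 1 = T.size := by
  simp only [fireOne, PMF.mem_support_bind_iff, PMF.mem_support_uniformOfFinset_iff,
    PMF.mem_support_map_iff] at hU
  obtain ⟨e, he, c, hc, rfl⟩ := hU
  exact size_tree_of_mem_support_fire hT he hc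

theorem inv_choose_mul_inv (n k : ℕ) :
    (((n + 1).choose (k + 1) : ℕ) : ENNReal)⁻¹ * ((k + 1 : ℕ) : ENNReal)⁻¹ =
      ((n + 1 : ℕ) : ENNReal)⁻¹ * ((n.choose k : ℕ) : ENNReal)⁻¹ := by
  rw [← ENNReal.mul_inv (by simp) (by simp), ← ENNReal.mul_inv (by simp) (by simp)]
  congr 1
  exact_mod_cast (Nat.add_one_mul_choose_eq n k).symm

/-- Firing `k` uniformly chosen employees amounts to `k` successive uniform firings. -/
theorem fireUniform_eq_map_fireIter (k : ℕ) (T : RootedSubtree T₀) (hk : k ≤ T.size) :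
    fireUniform T k hk = (fireIter k T).map RootedSubtree.verts := by
  classical
  induction k generalizing T with
  | zero =>
    ext b
    rw [fireUniform_apply, fireIter, PMF.pure_map, Finset.powersetCard_zero,
      Finset.sum_singleton, fireSet, Company.fireAll_empty, PMF.pure_map,
      Company.positions_start]
    simp
  | succ k ih =>
    have key : ∀ e ∈ T.verts, ∀ c ∈ ((Company.start T).fire e).support, ∀ b,
        (fireIter k c.tree).map RootedSubtree.verts b =
          ((T.size - 1).choose k : ENNReal)⁻¹ *
            ∑ S ∈ (T.verts.erase e).powersetCard k, (c.fireAll S).map Company.positions b := by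
      intro e he c hc b
      have hp := proper_of_mem_support_fire he hc
      -- If `T` is the root alone, the firing removes nobody. This can occur only for `k = 0`, where
      -- no further firing follows.
      rcases Nat.eq_zero_or_pos k with rfl | hpos
      · rw [fireIter, PMF.pure_map, Finset.powersetCard_zero, Finset.sum_singleton,
          Company.fireAll_empty, PMF.pure_map, hp.verts_tree]
        simp
      · have hT : 1 < T.size := by omega
        have hs := size_tree_of_mem_support_fire hT he hc
        rw [← ih c.tree (by omega),
          hp.fireUniform_tree_apply (isSome_iff_of_mem_support_fire hT he hc),
          Finset.card_erase_of_mem he]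
        rfl
    ext b
    calc fireUniform T (k + 1) hk b
        = (T.size.choose (k + 1) : ENNReal)⁻¹ * ∑ S ∈ T.verts.powersetCard (k + 1),
            ((k + 1 : ℕ) : ENNReal)⁻¹ * ∑ e ∈ S, ((Company.start T).fire e).bind
              (fun c => (c.fireAll (S.erase e)).map Company.positions) b := by
          rw [fireUniform_apply]
          congr 1
          refine Finset.sum_congr rfl fun S hS => ?_
          have hS' := (Finset.mem_powersetCard.mp hS).2
          rw [fireSet_apply_of_nonempty T (Finset.card_pos.mp (by omega)), hS']
      _ = (T.size : ENNReal)⁻¹ * ((T.size - 1).choose k : ENNReal)⁻¹ *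
            ∑ e ∈ T.verts, ∑ S ∈ (T.verts.erase e).powersetCard k,
              ((Company.start T).fire e).bind
                (fun c => (c.fireAll S).map Company.positions) b := by
          rw [← Finset.mul_sum, ← mul_assoc]
          obtain ⟨n, hn⟩ : ∃ n, T.size = n + 1 := ⟨T.size - 1, by omega⟩
          rw [hn, inv_choose_mul_inv, Nat.add_sub_cancel]
          congr 1
          exact sum_powersetCard_succ_sum_erase T.verts k fun e S =>
            ((Company.start T).fire e).bind
                (fun c => (c.fireAll S).map Company.positions) b
      _ = (T.size : ENNReal)⁻¹ * ∑ e ∈ T.verts, ((Company.start T).fire e).bind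
              (fun c => (fireIter k c.tree).map RootedSubtree.verts) b := by
          rw [mul_assoc, Finset.mul_sum]
          congr 1
          refine Finset.sum_congr rfl fun e he => ?_
          simp only [PMF.bind_apply, tsum_fintype]
          rw [Finset.sum_comm, Finset.mul_sum]
          refine Finset.sum_congr rfl fun c _ => ?_
          rw [← Finset.mul_sum, mul_left_comm]
          by_cases hc : c ∈ ((Company.start T).fire e).support
          · rw [key e he c hc b]
          · rw [PMF.mem_support_iff, not_not] at hc
            rw [hc, zero_mul, zero_mul]
      _ = (fireIter (k + 1) T).map RootedSubtree.verts b := by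
          rw [fireIter, fireOne, PMF.bind_bind, PMF.map_bind, uniformOfFinset_bind_apply]
          congr 1
          refine Finset.sum_congr rfl fun e _ => ?_
          rw [PMF.bind_map, PMF.map_bind]
          rfl

theorem fireUniform_verts (k : ℕ) (T U : RootedSubtree T₀) (hk : k ≤ T.size) :
    fireUniform T k hk U.verts = fireIter k T U := by
  rw [fireUniform_eq_map_fireIter, PMF.map_apply,
    tsum_eq_single U fun V hV => if_neg fun h => hV (RootedSubtree.ext h.symm), if_pos rfl]

end Iterate

/-! ### Spectrum read off from an eigenbasis -/

section Eigenbasis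

open Polynomial

variable {ι V : Type*} [Fintype ι] [AddCommGroup V] [Module ℝ V] {f : Module.End ℝ V}
  {b : Module.Basis ι ℝ V} {d : ι → ℝ}

theorem charpoly_eq_prod_of_eigenbasis [Module.Finite ℝ V]
    (h : ∀ i, f (b i) = d i • b i) : f.charpoly = ∏ i, (X - C (d i)) := by
  classical
  rw [← LinearMap.charpoly_toMatrix f b, ← Matrix.charpoly_diagonal]
  congr 1
  ext i j
  rw [LinearMap.toMatrix_apply, h, map_smul, Module.Basis.repr_self, Matrix.diagonal_apply]
  simp only [Finsupp.smul_apply, Finsupp.single_apply, smul_eq_mul]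
  by_cases hij : i = j
  · simp [hij]
  · simp [hij, Ne.symm hij]

theorem mem_eigenspace_iff_of_eigenbasis (h : ∀ i, f (b i) = d i • b i) {μ : ℝ} {v : V} :
    v ∈ Module.End.eigenspace f μ ↔ ∀ i, d i ≠ μ → b.repr v i = 0 := by
  have hrepr : ∀ i, b.repr (f v) i = d i * b.repr v i := by
    intro i
    have hv : f v = ∑ j, b.repr v j • d j • b j := by
      conv_lhs => rw [← b.sum_repr v]
      simp only [map_sum, map_smul, h]
    rw [hv]
    simp only [smul_smul]
    rw [b.repr_sum_self]
    exact mul_comm _ _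
  rw [Module.End.mem_eigenspace_iff]
  constructor
  · intro hv i hi
    have := hrepr i
    rw [hv, map_smul, Finsupp.smul_apply, smul_eq_mul] at this
    have h0 : (d i - μ) * b.repr v i = 0 := by rw [sub_mul, this, sub_self]
    exact (mul_eq_zero.mp h0).resolve_left (sub_ne_zero.mpr hi)
  · intro hv
    apply b.repr.injective
    ext i
    rw [hrepr, map_smul, Finsupp.smul_apply, smul_eq_mul]
    by_cases hi : d i = μ
    · rw [hi]
    · rw [hv i hi, mul_zero, mul_zero]

theorem eigenspace_eq_span_of_eigenbasis (h : ∀ i, f (b i) = d i • b i) (μ : ℝ) :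
    Module.End.eigenspace f μ =
      Submodule.span ℝ (Set.range fun i : {i // d i = μ} => b i) := by
  apply le_antisymm
  · intro v hv
    rw [mem_eigenspace_iff_of_eigenbasis h] at hv
    rw [← b.sum_repr v]
    refine Submodule.sum_mem _ fun i _ => ?_
    by_cases hi : d i = μ
    · exact Submodule.smul_mem _ _ (Submodule.subset_span ⟨⟨i, hi⟩, rfl⟩)
    · rw [hv i hi, zero_smul]; exact Submodule.zero_mem _
  · rw [Submodule.span_le]
    rintro _ ⟨⟨i, rfl⟩, rfl⟩
    exact Module.End.mem_eigenspace_iff.mpr (h i)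

theorem finrank_eigenspace_of_eigenbasis (h : ∀ i, f (b i) = d i • b i) (μ : ℝ) :
    Module.finrank ℝ (Module.End.eigenspace f μ) =
      (Finset.univ.filter fun i => d i = μ).card := by
  rw [eigenspace_eq_span_of_eigenbasis h, finrank_span_eq_card, Fintype.card_subtype]
  exact b.linearIndependent.comp _ Subtype.val_injective

theorem hasEigenvalue_iff_of_eigenbasis (h : ∀ i, f (b i) = d i • b i) (μ : ℝ) :
    Module.End.HasEigenvalue f μ ↔ ∃ i, d i = μ := by
  constructor
  · intro hμ
    by_contra! hne
    apply hμ
    rw [eq_bot_iff]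
    intro v hv
    rw [mem_eigenspace_iff_of_eigenbasis h] at hv
    rw [Submodule.mem_bot]
    apply b.repr.injective
    ext i
    rw [hv i (hne i)]; simp
  · rintro ⟨i, rfl⟩
    exact Module.End.hasEigenvalue_of_hasEigenvector
      ⟨Module.End.mem_eigenspace_iff.mpr (h i), b.ne_zero i⟩

theorem rootMultiplicity_prod_X_sub_C (d : ι → ℝ) (μ : ℝ) :
    (∏ i, (X - C (d i))).rootMultiplicity μ = (Finset.univ.filter fun i => d i = μ).card := by
  classical
  have : ∏ i, (X - C (d i)) = ((Finset.univ.val.map d).map fun a => X - C a).prod := by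
    rw [Multiset.map_map]; rfl
  rw [← count_roots, this, roots_multiset_prod_X_sub_C, Multiset.count_map]
  rw [Finset.card_def, Finset.filter_val]
  simp only [eq_comm]

end Eigenbasis

/-! ### The eigenfunctions and their triangularity -/

section Kernel

variable {T₀ : RootedTree} [Fintype T₀]

theorem toReal_bind_apply {α β : Type*} [Fintype α] (p : PMF α) (f : α → PMF β) (x : β) :
    (p.bind f x).toReal = ∑ a, (p a).toReal * (f a x).toReal := by
  rw [PMF.bind_apply, tsum_fintype, ENNReal.toReal_sum]
  · simp only [ENNReal.toReal_mul]
  · exact fun a _ => ENNReal.mul_ne_top (p.apply_ne_top a) ((f a).apply_ne_top x)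

theorem sum_toReal_apply {α : Type*} [Fintype α] (p : PMF α) : ∑ a, (p a).toReal = 1 := by
  rw [← ENNReal.toReal_sum fun a _ => p.apply_ne_top a, ← tsum_fintype (L := .unconditional _),
    p.tsum_coe,
    ENNReal.toReal_one]

theorem fireIter_add (a b : ℕ) (T : RootedSubtree T₀) :
    fireIter (a + b) T = (fireIter a T).bind (fireIter b) := by
  induction a generalizing T with
  | zero => rw [Nat.zero_add, fireIter, PMF.pure_bind]
  | succ a ih =>
    rw [Nat.add_right_comm, fireIter, fireIter, PMF.bind_bind]
    congr 1
    funext U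
    exact ih U

theorem fireOne_of_size_le_one {T : RootedSubtree T₀} (hT : T.size ≤ 1) :
    fireOne T = PMF.pure T := by
  simp only [fireOne, Company.fire_of_headcount_le_one ((Company.headcount_start T).le.trans hT),
    PMF.pure_map, Company.tree_start, PMF.bind_const]

/-- The size is deterministic; the maximum with `1` reflects that the root alone is absorbing. -/
theorem size_of_mem_support_fireIter {k : ℕ} {T U : RootedSubtree T₀}
    (hU : U ∈ (fireIter k T).support) : U.size = max (T.size - k) 1 := by
  induction k generalizing T with
  | zero =>
    rw [fireIter, PMF.mem_support_pure_iff] at hU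
    have := T.one_le_size
    rw [hU]; omega
  | succ k ih =>
    rw [fireIter, PMF.mem_support_bind_iff] at hU
    obtain ⟨V, hV, hU⟩ := hU
    rw [ih hU]
    by_cases hT : 1 < T.size
    · have := size_of_mem_support_fireOne hT hV
      omega
    · rw [fireOne_of_size_le_one (by omega), PMF.mem_support_pure_iff] at hV
      rw [hV]; omega

theorem subtreeFun_apply (T' T : RootedSubtree T₀) :
    subtreeFun T' T =
      (T.size.choose T'.size : ℝ) * (fireIter (T.size - T'.size) T T').toReal := by
  rw [subtreeFun, fireUniform_verts]

/-- As the size after `k` firings is deterministic, the binomial factor comes out of the sum, and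
`fireIter_add` composes the rest. Size `1` must be excluded: for `k ≥ T.size` absorption would make
the left side `1` and the right side `0`. -/
theorem sum_fireIter_mul_subtreeFun {T' : RootedSubtree T₀} (hT' : T'.size ≠ 1) (k : ℕ)
    (T : RootedSubtree T₀) :
    ∑ U, (fireIter k T U).toReal * subtreeFun T' U =
      ((T.size - k).choose T'.size : ℝ) * (fireIter (T.size - T'.size) T T').toReal := by
  have h1 := T'.one_le_size
  by_cases hk : T'.size ≤ T.size - k
  · have : T.size - T'.size = k + (T.size - k - T'.size) := by omega
    rw [this, fireIter_add, toReal_bind_apply, Finset.mul_sum]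
    refine Finset.sum_congr rfl fun U _ => ?_
    by_cases hU : U ∈ (fireIter k T).support
    · have hs := size_of_mem_support_fireIter hU
      rw [max_eq_left (by omega)] at hs
      rw [subtreeFun_apply, hs]
      ring
    · rw [PMF.mem_support_iff, not_not] at hU
      simp [hU]
  · rw [Nat.choose_eq_zero_of_lt (by omega), Nat.cast_zero, zero_mul]
    refine Finset.sum_eq_zero fun U _ => ?_
    by_cases hU : U ∈ (fireIter k T).support
    · have hs := size_of_mem_support_fireIter hU
      rw [subtreeFun_apply, Nat.choose_eq_zero_of_lt (by omega)]
      simp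
    · rw [PMF.mem_support_iff, not_not] at hU
      simp [hU]

theorem subtreeFun_self (T : RootedSubtree T₀) : subtreeFun T T = 1 := by
  simp [subtreeFun_apply, fireIter]

theorem subtreeFun_of_size_lt {T' T : RootedSubtree T₀} (h : T.size < T'.size) :
    subtreeFun T' T = 0 := by
  rw [subtreeFun_apply, Nat.choose_eq_zero_of_lt h]; simp

theorem subtreeFun_of_size_eq {T' T : RootedSubtree T₀} (h : T.size = T'.size) (hne : T' ≠ T) :
    subtreeFun T' T = 0 := by
  rw [subtreeFun_apply, h, Nat.sub_self, fireIter, PMF.pure_apply, if_neg hne]; simp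

/-- The eigenfunction indexed by `T'`: the constant function if `T'` is the root alone. -/
noncomputable def eigenFun (T' : RootedSubtree T₀) : RootedSubtree T₀ → ℝ :=
  if T'.size = 1 then fun _ => 1 else subtreeFun T'

/-- Unitriangularity by size: evaluating a relation at `T` kills the larger trees and the other
trees of equal size, and induction kills the smaller ones. -/
theorem linearIndependent_eigenFun :
    LinearIndependent ℝ (eigenFun : RootedSubtree T₀ → RootedSubtree T₀ → ℝ) := by
  rw [Fintype.linearIndependent_iff]
  intro a ha
  suffices ∀ n, ∀ T : RootedSubtree T₀, T.size = n → a T = 0 from fun T => this _ T rfl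
  intro n
  induction n using Nat.strong_induction_on with
  | _ n ih =>
    intro T hT
    have h := congrFun ha T
    rw [Finset.sum_apply, Finset.sum_eq_single T] at h
    · by_cases h1 : T.size = 1
      · simpa [eigenFun, h1] using h
      · simpa [eigenFun, h1, subtreeFun_self] using h
    · intro U _ hU
      rcases lt_trichotomy U.size T.size with hlt | heq | hgt
      · simp [ih U.size (hT ▸ hlt) U rfl]
      · have h1 : U.size ≠ 1 := fun h1 => hU <|
          (RootedSubtree.eq_single_of_size_eq_one h1).trans
            (RootedSubtree.eq_single_of_size_eq_one (heq ▸ h1)).symm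
        simp [eigenFun, h1, subtreeFun_of_size_eq heq.symm hU]
      · have h1 : U.size ≠ 1 := by have := T.one_le_size; omega
        simp [eigenFun, h1, subtreeFun_of_size_lt hgt]
    · simp

/-- The basis of eigenfunctions. -/
noncomputable def eigenBasis (T₀ : RootedTree) [Fintype T₀] :
    Module.Basis (RootedSubtree T₀) ℝ (RootedSubtree T₀ → ℝ) :=
  basisOfLinearIndependentOfCardEqFinrank' _ linearIndependent_eigenFun (by simp)

theorem eigenBasis_apply (T' : RootedSubtree T₀) : eigenBasis T₀ T' = eigenFun T' := by
  simp [eigenBasis]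

theorem RootedSubtree.size_le_card (T : RootedSubtree T₀) : T.size ≤ Fintype.card T₀ :=
  Finset.card_le_univ _

/-- The chain itself provides one: any possible outcome of firing all but `m` employees of the full
tree. -/
theorem exists_size_eq {m : ℕ} (h1 : 1 ≤ m) (hm : m ≤ Fintype.card T₀) :
    ∃ T : RootedSubtree T₀, T.size = m := by
  let W : RootedSubtree T₀ := .ofIsLowerSet Finset.univ (by simpa using isLowerSet_univ) (by simp)
  have hW : W.size = Fintype.card T₀ := rfl
  obtain ⟨U, hU⟩ := (fireIter (Fintype.card T₀ - m) W).support_nonempty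
  exact ⟨U, by have := size_of_mem_support_fireIter hU; omega⟩

theorem prod_ite_size_eq {M : Type*} [CommMonoid M] (x : M) (g : ℕ → M) :
    ∏ T : RootedSubtree T₀, (if T.size = 1 then x else g T.size) =
      x * ∏ j ∈ Finset.range (Fintype.card T₀ - 1),
        g (Fintype.card T₀ - j) ^ numSubtrees T₀ (Fintype.card T₀ - j) := by
  classical
  rw [Finset.prod_ite]
  congr 1
  · have : (Finset.univ.filter fun T : RootedSubtree T₀ => T.size = 1) = {.single T₀} := by
      ext T
      simp only [Finset.mem_filter, Finset.mem_univ, true_and, Finset.mem_singleton]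
      exact ⟨RootedSubtree.eq_single_of_size_eq_one, fun h => by rw [h]; simp⟩
    simp [this]
  -- Sizes from `2` to `n₀` correspond to `j = n₀ - size` from `0` to `n₀ - 2`.
  · rw [← Finset.prod_fiberwise_of_maps_to (t := Finset.range (Fintype.card T₀ - 1))
      (g := fun T : RootedSubtree T₀ => Fintype.card T₀ - T.size)]
    · refine Finset.prod_congr rfl fun j hj => ?_
      rw [Finset.mem_range] at hj
      rw [numSubtrees, ← Finset.prod_const]
      have : ((Finset.univ.filter fun T : RootedSubtree T₀ => ¬ T.size = 1).filter
          fun T => Fintype.card T₀ - T.size = j) =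
          Finset.univ.filter fun T : RootedSubtree T₀ => T.size = Fintype.card T₀ - j := by
        ext T
        have := T.size_le_card
        simp only [Finset.mem_filter, Finset.mem_univ, true_and]
        omega
      rw [this]
      refine Finset.prod_congr rfl fun T hT => ?_
      rw [(Finset.mem_filter.mp hT).2]
    · intro T hT
      have h1 := T.one_le_size
      have h2 := T.size_le_card
      simp only [Finset.mem_filter, Finset.mem_univ, true_and] at hT
      rw [Finset.mem_range]
      omega

end Kernel

/-! ### Eigenvalue equations for the two models -/

section Models

variable {T₀ : RootedTree}

/-- The event is a box with sides of length `1 - q` for employees in `S` and `q` for the others. -/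
theorem badPerformanceProb_eq {q : ℝ} (hq0 : 0 ≤ q) (hq1 : q ≤ 1) (T : RootedSubtree T₀)
    {S : Finset T₀} (hS : S ⊆ T.verts) :
    badPerformanceProb T q S = (1 - q) ^ S.card * q ^ (T.size - S.card) := by
  classical
  let r : unitInterval := ⟨1 - q, by linarith, by linarith⟩
  have hset : {x : T.verts → unitInterval | ∀ e : T.verts, (e : T₀) ∈ S ↔ (x e : ℝ) < 1 - q} =
      Set.pi Set.univ fun e : T.verts => if (e : T₀) ∈ S then Set.Iio r else Set.Ici r := by
    ext x
    simp only [Set.mem_ofPred_eq, Set.mem_pi, Set.mem_univ, true_implies]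
    refine forall_congr' fun e => ?_
    split_ifs with h
    · simp [h, r, ← Subtype.coe_lt_coe]
    · simp [h, r, ← Subtype.coe_le_coe]
  have hvol : ∀ e : T.verts,
      (volume (if (e : T₀) ∈ S then Set.Iio r else Set.Ici r)).toReal =
        if (e : T₀) ∈ S then 1 - q else q := by
    intro e
    split_ifs
    · rw [unitInterval.volume_Iio, ENNReal.toReal_ofReal r.2.1]
    · rw [unitInterval.volume_Ici, ENNReal.toReal_ofReal (by simpa [r] using hq0)]
      simp [r]
  rw [badPerformanceProb, hset, measureReal_def, volume_pi_pi, ENNReal.toReal_prod]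
  simp only [hvol]
  rw [Finset.prod_coe_sort T.verts fun e => if e ∈ S then 1 - q else q, Finset.prod_ite,
    Finset.prod_const, Finset.prod_const, Finset.filter_mem_eq_inter,
    Finset.inter_eq_right.mpr hS]
  congr 2
  rw [← Finset.sdiff_eq_filter, Finset.card_sdiff_of_subset hS, RootedSubtree.size]

variable [Fintype T₀]

theorem singleMatrix_apply (T U : RootedSubtree T₀) :
    singleMatrix T₀ T U =
      (T.size : ℝ) / Fintype.card T₀ * (fireIter 1 T U).toReal +
        ((Fintype.card T₀ : ℝ) - T.size) / Fintype.card T₀ * (if T = U then 1 else 0) := by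
  rw [singleMatrix, Matrix.of_apply, fireUniform_verts]

theorem singleMatrix_mulVec (f : RootedSubtree T₀ → ℝ) (T : RootedSubtree T₀) :
    (singleMatrix T₀).mulVec f T =
      (T.size : ℝ) / Fintype.card T₀ * (∑ U, (fireIter 1 T U).toReal * f U) +
        ((Fintype.card T₀ : ℝ) - T.size) / Fintype.card T₀ * f T := by
  simp only [Matrix.mulVec, dotProduct, singleMatrix_apply, add_mul, Finset.sum_add_distrib,
    Finset.mul_sum, mul_assoc]
  congr 1
  rw [Finset.sum_eq_single T]
  · simp
  · intro U _ h; simp [h.symm]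
  · simp

theorem cast_card_ne_zero : (Fintype.card T₀ : ℝ) ≠ 0 := by
  have : Nonempty T₀ := ⟨⊥⟩
  exact_mod_cast Fintype.card_ne_zero

theorem singleMatrix_mulVec_one : (singleMatrix T₀).mulVec (fun _ => 1) = fun _ => 1 := by
  funext T
  rw [singleMatrix_mulVec]
  have := cast_card_ne_zero (T₀ := T₀)
  simp only [mul_one, sum_toReal_apply]
  field_simp
  ring

theorem singleMatrix_mulVec_subtreeFun {T' : RootedSubtree T₀} (hT' : T'.size ≠ 1) :
    (singleMatrix T₀).mulVec (subtreeFun T') =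
      (((Fintype.card T₀ : ℝ) - T'.size) / Fintype.card T₀) • subtreeFun T' := by
  funext T
  rw [singleMatrix_mulVec, sum_fireIter_mul_subtreeFun hT', Pi.smul_apply, smul_eq_mul,
    subtreeFun_apply]
  have hc : (T.size : ℝ) * ((T.size - 1).choose T'.size : ℝ) =
      ((T.size : ℝ) - T'.size) * (T.size.choose T'.size : ℝ) := by
    obtain ⟨n, hn⟩ : ∃ n, T.size = n + 1 := ⟨T.size - 1, by have := T.one_le_size; omega⟩
    rw [hn, Nat.add_sub_cancel]
    rcases le_or_gt T'.size (n + 1) with h | h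
    · have := Nat.choose_mul_succ_eq n T'.size
      rw [← Nat.cast_sub h]
      exact_mod_cast (by rw [mul_comm, mul_comm (n + 1 - _)]; exact this)
    · rw [Nat.choose_eq_zero_of_lt h, Nat.choose_eq_zero_of_lt (by omega)]; simp
  have := cast_card_ne_zero (T₀ := T₀)
  field_simp
  linear_combination (fireIter (T.size - T'.size) T T').toReal * hc

theorem sum_toReal_fireSet (T U : RootedSubtree T₀) {k : ℕ} (hk : k ≤ T.size) :
    ∑ S ∈ T.verts.powersetCard k, (fireSet T S U.verts).toReal =
      (T.size.choose k : ℝ) * (fireIter k T U).toReal := by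
  have h0 : (T.size.choose k : ℝ) ≠ 0 := by exact_mod_cast (Nat.choose_pos hk).ne'
  rw [← fireUniform_verts k T U hk, fireUniform_apply, ENNReal.toReal_mul, ENNReal.toReal_inv,
    ENNReal.toReal_natCast, mul_inv_cancel_left₀ h0, ENNReal.toReal_sum]
  exact fun S _ => PMF.apply_ne_top _ _

/-- The probability of `S` depends only on its size, so the number fired is binomial and, given that
number, the fired set is uniform. -/
theorem binomialMatrix_apply {q : ℝ} (hq0 : 0 ≤ q) (hq1 : q ≤ 1) (T U : RootedSubtree T₀) :
    binomialMatrix T₀ q T U = ∑ k ∈ Finset.range (T.size + 1),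
      (T.size.choose k * ((1 - q) ^ k * q ^ (T.size - k))) * (fireIter k T U).toReal := by
  rw [binomialMatrix, Matrix.of_apply, Finset.sum_powerset]
  refine Finset.sum_congr rfl fun k hk => ?_
  have hk' : k ≤ T.size := by
    rw [Finset.mem_range] at hk; exact Nat.lt_succ_iff.mp hk
  rw [mul_right_comm, ← sum_toReal_fireSet T U hk', mul_comm, Finset.mul_sum]
  refine Finset.sum_congr rfl fun S hS => ?_
  obtain ⟨h1, h2⟩ := Finset.mem_powersetCard.mp hS
  rw [badPerformanceProb_eq hq0 hq1 T h1, h2]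

theorem binomialMatrix_mulVec {q : ℝ} (hq0 : 0 ≤ q) (hq1 : q ≤ 1) (f : RootedSubtree T₀ → ℝ)
    (T : RootedSubtree T₀) :
    (binomialMatrix T₀ q).mulVec f T = ∑ k ∈ Finset.range (T.size + 1),
      (T.size.choose k * ((1 - q) ^ k * q ^ (T.size - k))) *
        ∑ U, (fireIter k T U).toReal * f U := by
  simp only [Matrix.mulVec, dotProduct, binomialMatrix_apply hq0 hq1, Finset.sum_mul,
    Finset.mul_sum, mul_assoc]
  rw [Finset.sum_comm]

theorem sum_choose_mul_pow_eq_one (q : ℝ) (n : ℕ) :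
    ∑ k ∈ Finset.range (n + 1), (n.choose k * ((1 - q) ^ k * q ^ (n - k)) : ℝ) = 1 := by
  have := add_pow (1 - q) q n
  rw [sub_add_cancel, one_pow] at this
  exact (Finset.sum_congr rfl fun k _ => by ring).trans this.symm

theorem binomialMatrix_mulVec_one {q : ℝ} (hq0 : 0 ≤ q) (hq1 : q ≤ 1) :
    (binomialMatrix T₀ q).mulVec (fun _ => 1) = fun _ => 1 := by
  funext T
  rw [binomialMatrix_mulVec hq0 hq1]
  simp only [mul_one, sum_toReal_apply, sum_choose_mul_pow_eq_one]

/-- The binomial moment `E[C(X,m)]` of the number `X` of survivors, via `C(n,k) C(n-k,m) = C(n,m)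
C(n-m,k)` and the binomial theorem for `n - m`. -/
theorem sum_choose_mul_pow_mul_choose (q : ℝ) (n m : ℕ) :
    ∑ k ∈ Finset.range (n + 1),
      (n.choose k * ((1 - q) ^ k * q ^ (n - k)) * ((n - k).choose m) : ℝ) =
        q ^ m * n.choose m := by
  rcases lt_or_ge n m with h | h
  · rw [Nat.choose_eq_zero_of_lt h, Nat.cast_zero, mul_zero]
    refine Finset.sum_eq_zero fun k _ => ?_
    rw [Nat.choose_eq_zero_of_lt (n := _ - k) (by omega), Nat.cast_zero, mul_zero]
  · obtain ⟨l, rfl⟩ := Nat.exists_eq_add_of_le h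
    have hsub : Finset.range (l + 1) ⊆ Finset.range (m + l + 1) :=
      Finset.range_subset_range.mpr (by omega)
    rw [← Finset.sum_subset hsub]
    · conv_rhs => rw [← mul_one (q ^ m * _), ← sum_choose_mul_pow_eq_one q l, Finset.mul_sum]
      refine Finset.sum_congr rfl fun k hk => ?_
      have hk' : k ≤ l := by rw [Finset.mem_range] at hk; omega
      have hc : (m + l).choose k * (m + l - k).choose m = (m + l).choose m * l.choose k := by
        have := Nat.choose_mul (n := m + l) (k := m + l - k) (s := m) (by omega)
        rw [Nat.choose_symm (by omega)] at this
        rw [this, Nat.add_sub_cancel_left, show m + l - k - m = l - k by omega,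
          Nat.choose_symm hk']
      have hc' : ((m + l).choose k * (m + l - k).choose m : ℝ) =
          (m + l).choose m * l.choose k := by exact_mod_cast hc
      rw [show m + l - k = m + (l - k) by omega, pow_add] at *
      linear_combination (1 - q) ^ k * q ^ m * q ^ (l - k) * hc'
    · intro k hk₀ hk
      rw [Finset.mem_range] at hk₀ hk
      rw [Nat.choose_eq_zero_of_lt (n := _ - k) (by omega), Nat.cast_zero, mul_zero]

theorem binomialMatrix_mulVec_subtreeFun {q : ℝ} (hq0 : 0 ≤ q) (hq1 : q ≤ 1)
    {T' : RootedSubtree T₀} (hT' : T'.size ≠ 1) :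
    (binomialMatrix T₀ q).mulVec (subtreeFun T') = q ^ T'.size • subtreeFun T' := by
  funext T
  rw [binomialMatrix_mulVec hq0 hq1, Pi.smul_apply, smul_eq_mul, subtreeFun_apply, ← mul_assoc,
    ← sum_choose_mul_pow_mul_choose, Finset.sum_mul]
  refine Finset.sum_congr rfl fun k _ => ?_
  rw [sum_fireIter_mul_subtreeFun hT', mul_assoc _ _ (ENNReal.toReal _)]

theorem toLin'_eigenBasis {K : Matrix (RootedSubtree T₀) (RootedSubtree T₀) ℝ} {g : ℕ → ℝ}
    (h1 : K.mulVec (fun _ => 1) = fun _ => 1)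
    (h : ∀ T' : RootedSubtree T₀, T'.size ≠ 1 →
      K.mulVec (subtreeFun T') = g T'.size • subtreeFun T') (T' : RootedSubtree T₀) :
    Matrix.toLin' K (eigenBasis T₀ T') =
      (if T'.size = 1 then 1 else g T'.size) • eigenBasis T₀ T' := by
  rw [eigenBasis_apply, eigenFun, Matrix.toLin'_apply]
  split_ifs with hs
  · rw [h1, one_smul]
  · exact h T' hs

theorem charpoly_eq_of_eigenFun {K : Matrix (RootedSubtree T₀) (RootedSubtree T₀) ℝ} {g : ℕ → ℝ}
    (h1 : K.mulVec (fun _ => 1) = fun _ => 1)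
    (h : ∀ T' : RootedSubtree T₀, T'.size ≠ 1 →
      K.mulVec (subtreeFun T') = g T'.size • subtreeFun T') :
    K.charpoly = ∏ T' : RootedSubtree T₀,
      (Polynomial.X - Polynomial.C (if T'.size = 1 then 1 else g T'.size)) := by
  rw [← charpoly_eq_prod_of_eigenbasis (toLin'_eigenBasis h1 h), ← Matrix.charpoly_toLin']

theorem charpoly_eq_prod_range_of_eigenFun
    {K : Matrix (RootedSubtree T₀) (RootedSubtree T₀) ℝ} {g : ℕ → ℝ}
    (h1 : K.mulVec (fun _ => 1) = fun _ => 1)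
    (h : ∀ T' : RootedSubtree T₀, T'.size ≠ 1 →
      K.mulVec (subtreeFun T') = g T'.size • subtreeFun T') :
    K.charpoly = (Polynomial.X - Polynomial.C 1) *
      ∏ j ∈ Finset.range (Fintype.card T₀ - 1),
        (Polynomial.X - Polynomial.C (g (Fintype.card T₀ - j))) ^
          numSubtrees T₀ (Fintype.card T₀ - j) := by
  rw [charpoly_eq_of_eigenFun h1 h,
    ← prod_ite_size_eq (T₀ := T₀) _ fun s => Polynomial.X - Polynomial.C (g s)]
  refine Finset.prod_congr rfl fun T _ => ?_
  split_ifs <;> rfl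

/-- No tree has size `0`; `hg` only makes the constant function, indexed by `j = n₀`, fit the
formula for the other eigenvalues. -/
theorem hasEigenvalue_iff_of_eigenFun
    {K : Matrix (RootedSubtree T₀) (RootedSubtree T₀) ℝ} {g : ℕ → ℝ}
    (h1 : K.mulVec (fun _ => 1) = fun _ => 1)
    (h : ∀ T' : RootedSubtree T₀, T'.size ≠ 1 →
      K.mulVec (subtreeFun T') = g T'.size • subtreeFun T') (hg : g 0 = 1) (β : ℝ) :
    Module.End.HasEigenvalue (Matrix.toLin' K) β ↔
      ∃ j : ℕ, (j + 2 ≤ Fintype.card T₀ ∨ j = Fintype.card T₀) ∧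
        β = g (Fintype.card T₀ - j) := by
  rw [hasEigenvalue_iff_of_eigenbasis (toLin'_eigenBasis h1 h)]
  constructor
  · rintro ⟨T, hT⟩
    have ha := T.one_le_size
    have hb := T.size_le_card
    split_ifs at hT with hs
    · exact ⟨_, Or.inr rfl, by rw [Nat.sub_self, hg, hT]⟩
    · exact ⟨Fintype.card T₀ - T.size, Or.inl (by omega), by rw [← hT, Nat.sub_sub_self hb]⟩
  · rintro ⟨j, hj | rfl, rfl⟩
    · obtain ⟨T, hT⟩ := exists_size_eq (T₀ := T₀) (m := Fintype.card T₀ - j) (by omega) (by omega)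
      exact ⟨T, by rw [if_neg (by omega), hT]⟩
    · exact ⟨.single T₀, by rw [Nat.sub_self, hg, if_pos RootedSubtree.size_single]⟩

/-- The hypothesis `hm` says that `β` is attached to the trees of size `m` and to no others, so both
multiplicities count these trees. -/
theorem multiplicity_of_eigenFun
    {K : Matrix (RootedSubtree T₀) (RootedSubtree T₀) ℝ} {g : ℕ → ℝ}
    (h1 : K.mulVec (fun _ => 1) = fun _ => 1)
    (h : ∀ T' : RootedSubtree T₀, T'.size ≠ 1 →
      K.mulVec (subtreeFun T') = g T'.size • subtreeFun T') {m : ℕ} {β : ℝ}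
    (hm : ∀ s, 1 ≤ s → s ≤ Fintype.card T₀ → ((if s = 1 then 1 else g s) = β ↔ s = m)) :
    K.charpoly.rootMultiplicity β = numSubtrees T₀ m ∧
      Module.finrank ℝ (Module.End.eigenspace (Matrix.toLin' K) β) = numSubtrees T₀ m := by
  rw [charpoly_eq_of_eigenFun h1 h, rootMultiplicity_prod_X_sub_C,
    finrank_eigenspace_of_eigenbasis (toLin'_eigenBasis h1 h), and_self, numSubtrees]
  congr 1
  ext T
  simp only [Finset.mem_filter, Finset.mem_univ, true_and]
  exact hm _ T.one_le_size T.size_le_card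

theorem numSubtrees_one : numSubtrees T₀ 1 = 1 := by
  rw [numSubtrees, Finset.card_eq_one]
  refine ⟨.single T₀, ?_⟩
  ext T
  simp only [Finset.mem_filter, Finset.mem_univ, true_and, Finset.mem_singleton]
  exact ⟨RootedSubtree.eq_single_of_size_eq_one, fun h => by rw [h]; simp⟩

theorem hasEigenvector_of_mulVec {K : Matrix (RootedSubtree T₀) (RootedSubtree T₀) ℝ} {β : ℝ}
    {f : RootedSubtree T₀ → ℝ} (h : K.mulVec f = β • f) (T : RootedSubtree T₀) (hT : f T = 1) :
    Module.End.HasEigenvector (Matrix.toLin' K) β f :=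
  ⟨Module.End.mem_eigenspace_iff.mpr (by rw [Matrix.toLin'_apply, h]),
    fun h0 => by simp [h0] at hT⟩

end Models

end EmployeeFiring

/-! ### The main theorem -/

open EmployeeFiring Polynomial in
theorem theorem5p3 (T₀ : RootedTree) [Fintype T₀] (n₀ : ℕ) (hn₀ : Fintype.card T₀ = n₀)
    (q : ℝ) (hq0 : 0 ≤ q) (hq1 : q ≤ 1) :
    -- the eigenvalues
    (∀ β : ℝ, Module.End.HasEigenvalue (Matrix.toLin' (singleMatrix T₀)) β ↔
      ∃ j : ℕ, (j + 2 ≤ n₀ ∨ j = n₀) ∧ β = (j : ℝ) / n₀) ∧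
    (∀ β : ℝ, Module.End.HasEigenvalue (Matrix.toLin' (binomialMatrix T₀ q)) β ↔
      ∃ j : ℕ, (j + 2 ≤ n₀ ∨ j = n₀) ∧ β = q ^ (n₀ - j)) ∧
    -- the eigenvalues counted with multiplicity
    (singleMatrix T₀).charpoly = (X - C 1) *
      ∏ j ∈ Finset.range (n₀ - 1), (X - C ((j : ℝ) / n₀)) ^ numSubtrees T₀ (n₀ - j) ∧
    (binomialMatrix T₀ q).charpoly = (X - C 1) *
      ∏ j ∈ Finset.range (n₀ - 1), (X - C (q ^ (n₀ - j))) ^ numSubtrees T₀ (n₀ - j) ∧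
    -- algebraic and geometric multiplicities of the single eigenvalues
    ((singleMatrix T₀).charpoly.rootMultiplicity 1 = 1 ∧
      Module.finrank ℝ (Module.End.eigenspace (Matrix.toLin' (singleMatrix T₀)) 1) = 1) ∧
    (∀ j : ℕ, j + 2 ≤ n₀ →
      (singleMatrix T₀).charpoly.rootMultiplicity ((j : ℝ) / n₀) = numSubtrees T₀ (n₀ - j) ∧
      Module.finrank ℝ (Module.End.eigenspace (Matrix.toLin' (singleMatrix T₀)) ((j : ℝ) / n₀)) =
        numSubtrees T₀ (n₀ - j)) ∧
    (q < 1 →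
      (binomialMatrix T₀ q).charpoly.rootMultiplicity 1 = 1 ∧
      Module.finrank ℝ (Module.End.eigenspace (Matrix.toLin' (binomialMatrix T₀ q)) 1) = 1) ∧
    (0 < q → q < 1 → ∀ j : ℕ, j + 2 ≤ n₀ →
      (binomialMatrix T₀ q).charpoly.rootMultiplicity (q ^ (n₀ - j)) = numSubtrees T₀ (n₀ - j) ∧
      Module.finrank ℝ
          (Module.End.eigenspace (Matrix.toLin' (binomialMatrix T₀ q)) (q ^ (n₀ - j))) =
        numSubtrees T₀ (n₀ - j)) ∧
    -- the right eigenfunctions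
    (∀ T' : RootedSubtree T₀, T'.size ≠ 1 →
      Module.End.HasEigenvector (Matrix.toLin' (singleMatrix T₀))
        (((n₀ : ℝ) - T'.size) / n₀) (subtreeFun T') ∧
      Module.End.HasEigenvector (Matrix.toLin' (binomialMatrix T₀ q))
        (q ^ T'.size) (subtreeFun T')) ∧
    Module.End.HasEigenvector (Matrix.toLin' (singleMatrix T₀)) 1 (fun _ => 1) ∧
    Module.End.HasEigenvector (Matrix.toLin' (binomialMatrix T₀ q)) 1 (fun _ => 1) ∧
    -- the functions `subtreeFun T'` and the constant function form a basis
    (∃ b : Module.Basis (RootedSubtree T₀) ℝ (RootedSubtree T₀ → ℝ),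
      ∀ T' : RootedSubtree T₀, b T' = if T'.size = 1 then (fun _ => 1) else subtreeFun T') := by
  subst hn₀
  have hs1 := singleMatrix_mulVec_one (T₀ := T₀)
  have hb1 := binomialMatrix_mulVec_one (T₀ := T₀) hq0 hq1
  have hn := cast_card_ne_zero (T₀ := T₀)
  let g : ℕ → ℝ := fun s => ((Fintype.card T₀ : ℝ) - s) / Fintype.card T₀
  have hs : ∀ T' : RootedSubtree T₀, T'.size ≠ 1 →
      (singleMatrix T₀).mulVec (subtreeFun T') = g T'.size • subtreeFun T' :=
    fun T' h => singleMatrix_mulVec_subtreeFun h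
  have hb : ∀ T' : RootedSubtree T₀, T'.size ≠ 1 → (binomialMatrix T₀ q).mulVec (subtreeFun T') =
      (fun s => q ^ s) T'.size • subtreeFun T' :=
    fun T' h => binomialMatrix_mulVec_subtreeFun hq0 hq1 h
  have hg : ∀ j ≤ Fintype.card T₀, g (Fintype.card T₀ - j) = (j : ℝ) / Fintype.card T₀ := by
    intro j hj
    simp only [g]
    rw [Nat.cast_sub hj, sub_sub_cancel]
  have hg1 : ∀ s, g s = 1 ↔ s = 0 := by
    intro s
    simp only [g]
    rw [div_eq_one_iff_eq hn, sub_eq_self, Nat.cast_eq_zero]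
  have hginj : Function.Injective g := by
    intro s t h
    simp only [g] at h
    rw [div_left_inj' hn, sub_right_inj] at h
    exact_mod_cast h
  have hqne : q < 1 → ∀ s, s ≠ 0 → q ^ s ≠ 1 := fun h s hs => (pow_lt_one₀ hq0 h hs).ne
  refine ⟨?_, hasEigenvalue_iff_of_eigenFun hb1 hb (pow_zero q), ?_,
    charpoly_eq_prod_range_of_eigenFun hb1 hb, ?_, ?_, ?_, ?_, ?_, ?_, ?_, ?_⟩
  · intro β
    rw [hasEigenvalue_iff_of_eigenFun hs1 hs ((hg1 0).mpr rfl)]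
    refine exists_congr fun j => and_congr_right fun hj => ?_
    rw [hg j (by omega)]
  · rw [charpoly_eq_prod_range_of_eigenFun hs1 hs]
    congr 1
    refine Finset.prod_congr rfl fun j hj => ?_
    rw [Finset.mem_range] at hj
    rw [hg j (by omega)]
  · have := multiplicity_of_eigenFun hs1 hs (m := 1) (β := 1) fun s h1 _ => by
      split_ifs with h
      · simp [h]
      · simp only [hg1, h, iff_false]; omega
    rwa [numSubtrees_one] at this
  · intro j hj
    rw [← hg j (by omega)]
    refine multiplicity_of_eigenFun hs1 hs fun s h1 _ => ?_
    split_ifs with h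
    · rw [eq_comm, hg1]; omega
    · exact hginj.eq_iff
  · intro hq
    have := multiplicity_of_eigenFun hb1 hb (m := 1) (β := 1) fun s h1 _ => by
      split_ifs with h
      · simp [h]
      · simp only [hqne hq s (by omega), h]
    rwa [numSubtrees_one] at this
  · intro hq hq' j hj
    refine multiplicity_of_eigenFun hb1 hb fun s h1 _ => ?_
    split_ifs with h
    · refine iff_of_false (hqne hq' _ (by omega)).symm (by omega)
    -- Positivity of `q` is essential: at `q = 0` the eigenvalues of all sizes `s ≥ 2` coincide.
    · exact (pow_right_injective₀ hq hq'.ne).eq_iff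
  · exact fun T' hT' => ⟨hasEigenvector_of_mulVec (hs T' hT') T' (subtreeFun_self T'),
      hasEigenvector_of_mulVec (hb T' hT') T' (subtreeFun_self T')⟩
  · exact hasEigenvector_of_mulVec (by rw [hs1, one_smul]) (.single T₀) rfl
  · exact hasEigenvector_of_mulVec (by rw [hb1, one_smul]) (.single T₀) rfl
  · exact ⟨eigenBasis T₀, eigenBasis_apply⟩
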